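/- Let $R$ be a Noetherian local ring (commutative, with $1$) and let $J$ be an ideal of $R$ such that the Krull dimension of $R/J$ satisfies $\dim(R/J)\le 1$. Then the pair $(J,R)$ has the strong Artin–Rees property: there exists an integer $h\ge 0$, depending only on $R$ and $J$, such that for every ideal $I$ of $R$ and every integer $n\ge h$ one has $$I^{n}\cap J = I^{\,n-h}\,(I^{h}\cap J),$$ where $I^0=R$. -/

import Mathlib

/-- The pair `(N, M)` has the strong Artin-Rees property with respect to the family `W` of ideals
of `R`, with Artin-Rees number `h`: one has `I ^ n M ∩ N = I ^ (n - h) (I ^ h M ∩ N)` for every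
`I` in `W` and all `n ≥ h`. -/
def IsStrongArtinReesNumber {R : Type*} [CommRing R] {M : Type*} [AddCommGroup M] [Module R M]
    (N : Submodule R M) (W : Set (Ideal R)) (h : ℕ) : Prop :=
  ∀ I ∈ W, ∀ n : ℕ, h ≤ n →
    (I ^ n • (⊤ : Submodule R M)) ⊓ N = I ^ (n - h) • ((I ^ h • (⊤ : Submodule R M)) ⊓ N)

/-- The pair `(N, M)` has the strong Artin-Rees property: a single Artin-Rees number works for
the family of all ideals of `R`. -/
def HasStrongArtinReesProperty {R : Type*} [CommRing R] {M : Type*} [AddCommGroup M] [Module R M]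
    (N : Submodule R M) : Prop :=
  ∃ h : ℕ, IsStrongArtinReesNumber N Set.univ h

/-! Uniformity comes from a length bound. If A is Noetherian local of dimension at most 1 and y ∈ 𝔪
is a nonzerodivisor, every ideal Q of finite colength has length(Q/𝔪Q) ≤ e := length(A/yA). So for
every I containing a nonzerodivisor, all graded pieces of Rees(I)/𝔪 Rees(I) have dimension at most
e. Two forms of equal degree then satisfy a binary relation of degree e, hence are nilpotent modulo
a single form. Induction over the at most e generators, then Nakayama, gives
`exists_pow_le_span_mul_pow`: I^N ⊆ f I^(N-D) with f ∈ I^D and D, N independent of I. Allowing D > 1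
avoids any need for an infinite residue field.

Applied to R/J, this yields I^(n+1) ∩ J ⊆ I(I^n ∩ J) for n ≥ N when I has an element regular modulo
J. In general, decompose J into primary components: those whose radical contains I contain a fixed
power of I and drop out, and prime avoidance finds an element of I regular modulo the intersection
of the rest. Finitely many such intersections occur, so one h suffices. -/

open scoped Polynomial

/-! ### Elimination with a binary form -/

/-- Two elements `x`, `y` of a commutative algebra satisfying a binary form of degree `e` with a
unit coefficient are nilpotent modulo a single form in `x`, `y` of degree `e + 1`. -/
theorem exists_form_dvd_pow {A B : Type*} [CommRing A] [CommRing B] [Algebra A B] (x y : B)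
    (e s : ℕ) (hs : s ≤ e) (c : ℕ → A)
    (H : x ^ (e - s) * y ^ s + ∑ i ∈ Finset.Ioc s e, c i • (x ^ (e - i) * y ^ i) = 0) :
    y ^ (e + 1) + (x ^ (e + 1) + ∑ i ∈ Finset.Ioc s e, c i • (x ^ (e - i + s + 1) * y ^ (i - s)))
        ∣ y ^ (2 * e + 1) ∧
      y ^ (e + 1) + (x ^ (e + 1) + ∑ i ∈ Finset.Ioc s e, c i • (x ^ (e - i + s + 1) * y ^ (i - s)))
        ∣ x ^ ((e + 1) * (2 * e + 1)) := by
  set P := y ^ (e + 1) +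
    (x ^ (e + 1) + ∑ i ∈ Finset.Ioc s e, c i • (x ^ (e - i + s + 1) * y ^ (i - s))) with hP
  -- The exponents in P are chosen so that y^s times its part after y^(e+1) is x^(s+1) times the
  -- relation, hence 0.
  have h1 : y ^ s * P = y ^ (s + e + 1) := by
    have : y ^ s * (x ^ (e + 1) + ∑ i ∈ Finset.Ioc s e,
        c i • (x ^ (e - i + s + 1) * y ^ (i - s))) = x ^ (s + 1) * 0 := by
      rw [← H, mul_add, mul_add, Finset.mul_sum, Finset.mul_sum]
      congr 1
      · rw [← mul_assoc, ← pow_add, mul_comm]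
        congr 2
        omega
      · refine Finset.sum_congr rfl fun i hi => ?_
        obtain ⟨k, rfl⟩ : ∃ k, i = s + k := ⟨i - s, by grind⟩
        rw [mul_smul_comm, mul_smul_comm, Nat.add_sub_cancel_left]
        congr 1
        ring
    rw [hP, mul_add, this]
    ring
  have hy : P ∣ y ^ (2 * e + 1) :=
    (Dvd.intro_left _ h1).trans (pow_dvd_pow _ (by omega))
  refine ⟨hy, ?_⟩
  -- As i > s in the sum, y divides every term of P except x^(e+1); so x^(e+1) is a multiple of y
  -- modulo P.
  have hz : y ∣ y ^ (e + 1) + ∑ i ∈ Finset.Ioc s e, c i • (x ^ (e - i + s + 1) * y ^ (i - s)) := by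
    refine dvd_add (dvd_pow_self _ (by omega)) (Finset.dvd_sum fun i hi => ?_)
    refine dvd_smul_of_dvd _ (Dvd.dvd.mul_left (dvd_pow_self _ ?_) _)
    grind
  obtain ⟨q, hq⟩ := hz
  have hx : x ^ (e + 1) = P - y * q := by rw [hP, ← hq]; ring
  have h2 : P ∣ (x ^ (e + 1)) ^ (2 * e + 1) - (-(y * q)) ^ (2 * e + 1) := by
    refine dvd_trans ?_ (sub_dvd_pow_sub_pow _ _ _)
    rw [hx]
    simp
  have h3 : P ∣ (-(y * q)) ^ (2 * e + 1) := by
    rw [neg_pow, mul_pow]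
    exact (hy.mul_right _).mul_left _
  rw [pow_mul]
  simpa using dvd_add h2 h3

/-! ### Length bounds and linear relations -/

/-- If an ideal `Q` has finite colength and `y` is a nonzerodivisor in `𝔪`, then the length of
`Q / 𝔪Q` is at most that of `A / yA`. -/
theorem length_quotient_smul_le {A : Type*} [CommRing A] (m : Ideal A) (y : A) (hy : y ∈ m)
    (hreg : y ∈ nonZeroDivisors A) (Q : Submodule A A) (hQ : Module.length A (A ⧸ Q) ≠ ⊤) :
    Module.length A (Q ⧸ (m • Q).comap Q.subtype) ≤
      Module.length A (A ⧸ (Submodule.span A {y} : Submodule A A)) := by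
  set P : Submodule A A := Q.map (LinearMap.mulLeft A y) with hPdef
  have hPQ : P ≤ Q := by
    rintro _ ⟨q, hq, rfl⟩
    exact Q.smul_mem y hq
  have hPm : P ≤ m • Q := by
    rintro _ ⟨q, hq, rfl⟩
    exact Submodule.smul_mem_smul hy hq
  have hPy : P ≤ Submodule.span A {y} := by
    rintro _ ⟨q, hq, rfl⟩
    exact Submodule.mem_span_singleton.2 ⟨q, mul_comm _ _⟩
  -- The length of A/yQ is computed through Q and through yA; the finite length of A/Q then cancels.
  have e1 : Module.length A (A ⧸ P) =
      Module.length A (Q ⧸ P.comap Q.subtype) + Module.length A (A ⧸ Q) := by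
    refine Module.length_eq_add_of_exact (Submodule.mapQ (P.comap Q.subtype) P Q.subtype le_rfl)
      (Submodule.factor hPQ) ?_ (Submodule.factor_surjective hPQ) ?_
    · rw [← LinearMap.ker_eq_bot, Submodule.ker_mapQ, Submodule.mkQ_map_self]
    · rw [LinearMap.exact_iff, Submodule.range_mapQ, Submodule.factor, Submodule.ker_mapQ]
      simp
  have e2 : Module.length A (A ⧸ P) =
      Module.length A (A ⧸ Q) + Module.length A (A ⧸ (Submodule.span A {y} : Submodule A A)) := by
    have hc : P.comap (LinearMap.mulLeft A y) = Q :=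
      Submodule.comap_map_eq_of_injective
        (fun a b h => (mul_cancel_left_mem_nonZeroDivisors hreg).1 h) Q
    refine Module.length_eq_add_of_exact (Submodule.mapQ Q P (LinearMap.mulLeft A y) hc.ge)
      (Submodule.factor hPy) ?_ (Submodule.factor_surjective hPy) ?_
    · rw [← LinearMap.ker_eq_bot, Submodule.ker_mapQ, hc, Submodule.mkQ_map_self]
    · rw [LinearMap.exact_iff, Submodule.range_mapQ, Submodule.factor, Submodule.ker_mapQ]
      congr 1
      ext z
      simp [Submodule.mem_span_singleton, mul_comm]
  have e3 := e1.symm.trans e2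
  rw [add_comm] at e3
  replace e3 := WithTop.add_left_cancel hQ e3
  rw [← e3]
  exact Module.length_le_of_surjective (Submodule.factor (Submodule.comap_mono hPm))
    (Submodule.factor_surjective _)

/-- In a module of length at most `e`, among `e + 1` elements there is one in the span of the
later ones. -/
theorem exists_mem_span_of_length_le {A V : Type*} [CommRing A] [AddCommGroup V] [Module A V]
    (e : ℕ) (hV : Module.length A V ≤ e) (v : ℕ → V) :
    ∃ s ≤ e, v s ∈ Submodule.span A (v '' Finset.Ioc s e) := by
  by_contra! hcon
  -- The i-th term is spanned by the last i vectors; strictness at every step would force length at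
  -- least e + 1.
  let p : LTSeries (Submodule A V) :=
    { length := e + 1
      toFun := fun i => Submodule.span A (v '' {j | e < j + i ∧ j ≤ e})
      step := by
        intro i
        refine lt_of_le_of_ne (Submodule.span_mono (Set.image_mono fun j hj => ?_)) fun h => ?_
        · simp only [Fin.val_castSucc, Fin.val_succ, Set.mem_ofPred_eq] at hj ⊢
          omega
        · have hi := i.2
          refine hcon (e - i) (by omega) ?_
          have hmem : v (e - i) ∈ Submodule.span A (v '' {j | e < j + i.succ ∧ j ≤ e}) := by
            refine Submodule.subset_span ⟨_, ?_, rfl⟩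
            simp only [Fin.val_succ, Set.mem_ofPred_eq]
            omega
          rw [← h] at hmem
          refine Submodule.span_mono (Set.image_mono fun j hj => ?_) hmem
          simp only [Fin.val_castSucc, Set.mem_ofPred_eq, Finset.coe_Ioc, Set.mem_Ioc] at hj ⊢
          omega }
  have h1 : ((e + 1 : ℕ) : WithBot ℕ∞) ≤ Order.krullDim (Submodule A V) :=
    Order.LTSeries.length_le_krullDim p
  rw [← Module.coe_length] at h1
  have h2 : ((e + 1 : ℕ) : ℕ∞) ≤ Module.length A V := by exact_mod_cast h1
  have h3 := h2.trans hV
  rw [Nat.cast_le] at h3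
  omega

/-- If `Q / 𝔪Q` has length at most `e`, any `e + 1` elements of `Q` satisfy a linear relation
modulo `𝔪Q` with a unit coefficient. -/
theorem exists_linear_relation_of_length_le {A : Type*} [CommRing A] (m : Ideal A)
    (Q : Submodule A A) (e : ℕ) (h : Module.length A (Q ⧸ (m • Q).comap Q.subtype) ≤ e)
    (u : ℕ → A) (hu : ∀ i ≤ e, u i ∈ Q) :
    ∃ s ≤ e, ∃ c : ℕ → A, u s + ∑ i ∈ Finset.Ioc s e, c i * u i ∈ m • Q := by
  classical
  let w : ℕ → Q := fun i => if hi : i ≤ e then ⟨u i, hu i hi⟩ else 0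
  have hw : ∀ i ≤ e, (w i : A) = u i := fun i hi => by simp [w, hi]
  obtain ⟨s, hs, hmem⟩ := exists_mem_span_of_length_le e h (fun i => Submodule.Quotient.mk (w i))
  rw [Submodule.mem_span_image_finset_iff_exists_fun'] at hmem
  obtain ⟨c, hc⟩ := hmem
  refine ⟨s, hs, fun i => -c i, ?_⟩
  simp_rw [← Submodule.mkQ_apply, ← map_smul, ← map_sum] at hc
  have h2 := (Submodule.Quotient.eq _).1 hc.symm
  simp only [Submodule.mem_comap, Submodule.subtype_apply, Submodule.coe_sub,
    Submodule.coe_sum, Submodule.coe_smul, smul_eq_mul] at h2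
  have h3 : u s + ∑ i ∈ Finset.Ioc s e, -c i * u i =
      (w s : A) - ∑ i ∈ Finset.Ioc s e, c i * (w i : A) := by
    rw [hw s hs, sub_eq_add_neg, ← Finset.sum_neg_distrib]
    congr 1
    refine Finset.sum_congr rfl fun i hi => ?_
    rw [hw i (Finset.mem_Ioc.1 hi).2, neg_mul]
  rw [h3]
  exact h2

/-! ### The fiber ring of the Rees algebra -/

/-- The extension of an ideal `m` to the Rees algebra of `I`, described by coefficients. -/
def reesExtension {A : Type*} [CommRing A] (I m : Ideal A) : Ideal (reesAlgebra I) where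
  carrier := {z | ∀ n, (z : A[X]).coeff n ∈ m * I ^ n}
  zero_mem' n := by simp
  add_mem' ha hb n := by
    simpa using add_mem (ha n) (hb n)
  smul_mem' c z hz n := by
    simp only [smul_eq_mul, MulMemClass.coe_mul, Polynomial.coeff_mul]
    refine Ideal.sum_mem _ fun p hp => ?_
    have hn : p.1 + p.2 = n := by simpa using hp
    rw [← hn, pow_add, mul_left_comm]
    exact Ideal.mul_mem_mul ((mem_reesAlgebra_iff I c).1 c.2 _) (hz _)

/-- The homogeneous element of degree `n` of the Rees algebra given by an element of `I ^ n`. -/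
noncomputable def reesMonomial {A : Type*} [CommRing A] (I : Ideal A) (n : ℕ) (u : A) (hu : u ∈ I ^ n) :
    reesAlgebra I :=
  ⟨Polynomial.monomial n u, reesAlgebra.monomial_mem.2 hu⟩

/-- The fiber ring `Rees(I) / m Rees(I)`. -/
def FiberRing {A : Type*} [CommRing A] (I m : Ideal A) : Type _ :=
  reesAlgebra I ⧸ reesExtension I m

noncomputable instance {A : Type*} [CommRing A] (I m : Ideal A) : CommRing (FiberRing I m) :=
  inferInstanceAs (CommRing (reesAlgebra I ⧸ reesExtension I m))

noncomputable instance {A : Type*} [CommRing A] (I m : Ideal A) : Algebra A (FiberRing I m) :=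
  inferInstanceAs (Algebra A (reesAlgebra I ⧸ reesExtension I m))

/-- The projection from the Rees algebra to the fiber ring. -/
noncomputable def FiberRing.mk {A : Type*} [CommRing A] (I m : Ideal A) :
    reesAlgebra I →ₐ[A] FiberRing I m :=
  Ideal.Quotient.mkₐ A (reesExtension I m)

theorem FiberRing.mk_surjective {A : Type*} [CommRing A] (I m : Ideal A) :
    Function.Surjective (FiberRing.mk I m) :=
  Ideal.Quotient.mk_surjective

theorem FiberRing.mk_eq_mk_iff {A : Type*} [CommRing A] {I m : Ideal A} {x y : reesAlgebra I} :
    FiberRing.mk I m x = FiberRing.mk I m y ↔ x - y ∈ reesExtension I m :=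
  Ideal.Quotient.eq

/-- The class of a homogeneous element in the fiber ring `Rees(I) / m Rees(I)`. -/
noncomputable def fiberMonomial {A : Type*} [CommRing A] (I m : Ideal A) (n : ℕ) (u : A) (hu : u ∈ I ^ n) :
    FiberRing I m :=
  FiberRing.mk I m (reesMonomial I n u hu)

section

variable {A : Type*} [CommRing A] {I m : Ideal A}

theorem reesMonomial_mem_reesExtension {n : ℕ} {u : A} (hu : u ∈ I ^ n) (h : u ∈ m * I ^ n) :
    reesMonomial I n u hu ∈ reesExtension I m := by
  intro k
  simp only [reesMonomial, Polynomial.coeff_monomial]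
  split_ifs with hk
  · exact hk ▸ h
  · exact zero_mem _

theorem fiberMonomial_eq_zero {n : ℕ} {u : A} (hu : u ∈ I ^ n) (h : u ∈ m * I ^ n) :
    fiberMonomial I m n u hu = 0 :=
  (FiberRing.mk_eq_mk_iff.2 (by rw [sub_zero]; exact reesMonomial_mem_reesExtension hu h)).trans
    (map_zero _)

theorem fiberMonomial_add {n : ℕ} {u v : A} (hu : u ∈ I ^ n) (hv : v ∈ I ^ n) :
    fiberMonomial I m n (u + v) (add_mem hu hv) =
      fiberMonomial I m n u hu + fiberMonomial I m n v hv := by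
  rw [fiberMonomial, fiberMonomial, fiberMonomial, ← map_add]
  congr 1
  exact Subtype.ext (map_add _ _ _)

theorem fiberMonomial_smul {n : ℕ} (c : A) {u : A} (hu : u ∈ I ^ n) :
    fiberMonomial I m n (c * u) (Ideal.mul_mem_left _ c hu) = c • fiberMonomial I m n u hu := by
  rw [fiberMonomial, fiberMonomial, ← map_smul]
  congr 1
  exact Subtype.ext (Polynomial.smul_monomial c n u).symm

theorem fiberMonomial_sum {n : ℕ} (s : Finset ℕ) (u : ℕ → A) (hu : ∀ i ∈ s, u i ∈ I ^ n) :
    fiberMonomial I m n (∑ i ∈ s, u i) (Ideal.sum_mem _ hu) =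
      ∑ i ∈ s.attach, fiberMonomial I m n (u i) (hu i i.2) := by
  simp_rw [fiberMonomial, ← map_sum]
  congr 1
  refine Subtype.ext ?_
  simp only [reesMonomial, map_sum, AddSubmonoidClass.coe_finsetSum]
  exact (Finset.sum_attach s fun i => Polynomial.monomial n (u i)).symm

theorem fiberMonomial_mul {n k : ℕ} {u v : A} (hu : u ∈ I ^ n) (hv : v ∈ I ^ k) :
    fiberMonomial I m (n + k) (u * v) (by rw [pow_add]; exact Ideal.mul_mem_mul hu hv) =
      fiberMonomial I m n u hu * fiberMonomial I m k v hv := by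
  rw [fiberMonomial, fiberMonomial, fiberMonomial, ← map_mul]
  congr 1
  exact Subtype.ext (Polynomial.monomial_mul_monomial _ _ _ _).symm

theorem fiberMonomial_pow {n : ℕ} {u : A} (hu : u ∈ I ^ n) (k : ℕ) :
    fiberMonomial I m (n * k) (u ^ k) (by rw [pow_mul]; exact Ideal.pow_mem_pow hu k) =
      fiberMonomial I m n u hu ^ k := by
  rw [fiberMonomial, fiberMonomial, ← map_pow]
  congr 1
  exact Subtype.ext (Polynomial.monomial_pow _ _ _).symm

theorem fiberMonomial_congr {n k : ℕ} {u v : A} (hnk : n = k) (huv : u = v) (hu : u ∈ I ^ n)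
    (hv : v ∈ I ^ k) : fiberMonomial I m n u hu = fiberMonomial I m k v hv := by
  subst hnk huv
  rfl

theorem fiberMonomial_pow_mul_pow {d i j n : ℕ} {f g : A} (hf : f ∈ I ^ d) (hg : g ∈ I ^ d)
    (hn : i + j = n) (hu : f ^ i * g ^ j ∈ I ^ (d * n)) :
    fiberMonomial I m (d * n) (f ^ i * g ^ j) hu =
      fiberMonomial I m d f hf ^ i * fiberMonomial I m d g hg ^ j := by
  rw [← fiberMonomial_pow, ← fiberMonomial_pow, ← fiberMonomial_mul]
  exact fiberMonomial_congr (by rw [← hn, mul_add]) rfl _ _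

theorem pow_mul_pow_mem {d i j n : ℕ} {f g : A} (hf : f ∈ I ^ d) (hg : g ∈ I ^ d)
    (hn : i + j = n) : f ^ i * g ^ j ∈ I ^ (d * n) := by
  rw [← hn, mul_add, pow_add, pow_mul, pow_mul]
  exact Ideal.mul_mem_mul (Ideal.pow_mem_pow hf i) (Ideal.pow_mem_pow hg j)

/-! ### Principal reductions from bounded fibers -/

variable (I m) in
/-- Any `e + 1` elements of a power of `I` satisfy a linear relation modulo `m` with a unit
coefficient. -/
def FiberDimLE (e : ℕ) : Prop :=
  ∀ n, ∀ u : ℕ → A, (∀ i ≤ e, u i ∈ I ^ n) →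
    ∃ s ≤ e, ∃ c : ℕ → A, u s + ∑ i ∈ Finset.Ioc s e, c i * u i ∈ m * I ^ n

/-- Two elements of the same degree in the fiber ring are nilpotent modulo a single
homogeneous element of controlled degree. -/
theorem FiberDimLE.exists_dvd_pow {e : ℕ} (he : FiberDimLE I m e) {d : ℕ} {f g : A}
    (hf : f ∈ I ^ d) (hg : g ∈ I ^ d) :
    ∃ p, ∃ hp : p ∈ I ^ (d * (e + 1)),
      fiberMonomial I m _ p hp ∣ fiberMonomial I m d g hg ^ (2 * e + 1) ∧
      fiberMonomial I m _ p hp ∣ fiberMonomial I m d f hf ^ ((e + 1) * (2 * e + 1)) := by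
  have hu : ∀ i ≤ e, f ^ (e - i) * g ^ i ∈ I ^ (d * e) :=
    fun i hi => pow_mul_pow_mem hf hg (by omega)
  obtain ⟨s, hs, c, hc⟩ := he (d * e) (fun i => f ^ (e - i) * g ^ i) hu
  have hle : ∀ i ∈ Finset.Ioc s e, i ≤ e := fun i hi => (Finset.mem_Ioc.1 hi).2
  have H : fiberMonomial I m d f hf ^ (e - s) * fiberMonomial I m d g hg ^ s +
      ∑ i ∈ Finset.Ioc s e, c i •
        (fiberMonomial I m d f hf ^ (e - i) * fiberMonomial I m d g hg ^ i) = 0 := by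
    rw [← fiberMonomial_eq_zero
      (add_mem (hu s hs) (Ideal.sum_mem _ fun i hi => Ideal.mul_mem_left _ (c i) (hu i (hle i hi))))
      hc, fiberMonomial_add (hu s hs)
        (Ideal.sum_mem _ fun i hi => Ideal.mul_mem_left _ (c i) (hu i (hle i hi))),
      fiberMonomial_sum _ (fun i => c i * (f ^ (e - i) * g ^ i))
        (fun i hi => Ideal.mul_mem_left _ (c i) (hu i (hle i hi))),
      fiberMonomial_pow_mul_pow hf hg (by omega)]
    congr 1
    rw [← Finset.sum_attach]
    refine Finset.sum_congr rfl fun i _ => ?_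
    have hi := hle i i.2
    rw [fiberMonomial_smul _ (hu i hi), fiberMonomial_pow_mul_pow hf hg (by omega)]
  have hex : ∀ i ∈ Finset.Ioc s e, (e - i + s + 1) + (i - s) = e + 1 := fun i hi => by
    have := Finset.mem_Ioc.1 hi
    omega
  have hv : ∀ i ∈ Finset.Ioc s e, c i * (f ^ (e - i + s + 1) * g ^ (i - s)) ∈ I ^ (d * (e + 1)) :=
    fun i hi => Ideal.mul_mem_left _ _ (pow_mul_pow_mem hf hg (hex i hi))
  have hf' : f ^ (e + 1) ∈ I ^ (d * (e + 1)) := by rw [pow_mul]; exact Ideal.pow_mem_pow hf _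
  have hg' : g ^ (e + 1) ∈ I ^ (d * (e + 1)) := by rw [pow_mul]; exact Ideal.pow_mem_pow hg _
  refine ⟨g ^ (e + 1) + (f ^ (e + 1) +
    ∑ i ∈ Finset.Ioc s e, c i * (f ^ (e - i + s + 1) * g ^ (i - s))),
    add_mem hg' (add_mem hf' (Ideal.sum_mem _ hv)), ?_⟩
  have key := exists_form_dvd_pow _ _ e s hs c H
  convert key using 2
  all_goals
    rw [fiberMonomial_add hg' (add_mem hf' (Ideal.sum_mem _ hv)),
      fiberMonomial_add hf' (Ideal.sum_mem _ hv), fiberMonomial_sum _ _ hv, fiberMonomial_pow hf,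
      fiberMonomial_pow hg]
    congr 2
    rw [← Finset.sum_attach (Finset.Ioc s e)]
    refine Finset.sum_congr rfl fun i _ => ?_
    rw [fiberMonomial_smul _ (pow_mul_pow_mem hf hg (hex i i.2)),
      fiberMonomial_pow_mul_pow hf hg (hex i i.2)]

variable (I m) in
/-- The ideal of the fiber ring generated by the classes in degree one of a set of elements. -/
noncomputable def fiberSpan (T : Set A) : Ideal (FiberRing I m) :=
  Ideal.span {b | ∃ u ∈ T, ∃ hu : u ∈ I ^ 1, b = fiberMonomial I m 1 u hu}

/-- A power of the ideal generated by `j` elements of degree one lies in a principal ideal with a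
homogeneous generator; exponent and degree depend on `j` and `e` only. -/
theorem exists_fiberSpan_pow_le (m : Ideal A) (e j : ℕ) :
    ∃ D ≥ 1, ∃ N, ∀ I : Ideal A, FiberDimLE I m e → ∀ T : Finset A, T.card ≤ j → (T : Set A) ⊆ I →
      ∃ f, ∃ hf : f ∈ I ^ D, fiberSpan I m T ^ N ≤ Ideal.span {fiberMonomial I m D f hf} := by
  classical
  induction j with
  | zero =>
    refine ⟨1, le_rfl, 1, fun I _ T hT _ => ⟨0, zero_mem _, ?_⟩⟩
    rw [Finset.card_eq_zero.1 (Nat.le_zero.1 hT)]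
    simp [fiberSpan]
  | succ j ih =>
    obtain ⟨D, hD, N, h⟩ := ih
    -- Raising the new generator a to the power D puts it in the degree of f. The exponent adds what
    -- the old generators need to what a needs, as (𝔞 + 𝔟)^(k+l) ⊆ 𝔞^k + 𝔟^l.
    refine ⟨D * (e + 1), Nat.mul_pos hD e.succ_pos, N * ((e + 1) * (2 * e + 1)) + D * (2 * e + 1), ?_⟩
    intro I he T hT hTI
    rcases T.eq_empty_or_nonempty with rfl | ⟨a, haT⟩
    · refine ⟨0, zero_mem _, ?_⟩
      have : N * ((e + 1) * (2 * e + 1)) + D * (2 * e + 1) ≠ 0 :=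
        (Nat.add_pos_right _ (Nat.mul_pos hD (2 * e).succ_pos)).ne'
      have hbot : fiberSpan I m ((∅ : Finset A) : Set A) = ⊥ := by simp [fiberSpan]
      rw [hbot, Ideal.bot_pow this]
      exact bot_le
    obtain ⟨T', rfl, hT'⟩ : ∃ T', insert a T' = T ∧ T'.card ≤ j :=
      ⟨T.erase a, Finset.insert_erase haT, by rw [Finset.card_erase_of_mem haT]; omega⟩
    rw [Finset.coe_insert, Set.insert_subset_iff] at hTI
    obtain ⟨f, hf, hfN⟩ := h I he T' hT' hTI.2
    have ha : a ∈ I ^ 1 := by rw [pow_one]; exact hTI.1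
    have haD : a ^ D ∈ I ^ D := Ideal.pow_mem_pow hTI.1 D
    obtain ⟨p, hp, hpy, hpx⟩ := he.exists_dvd_pow hf haD
    refine ⟨p, hp, ?_⟩
    have hsplit : fiberSpan I m ↑(insert a T') ≤
        fiberSpan I m T' ⊔ Ideal.span {fiberMonomial I m 1 a ha} := by
      refine Ideal.span_le.2 ?_
      rintro b ⟨u, hu, hu1, rfl⟩
      rw [Finset.coe_insert, Set.mem_insert_iff] at hu
      rcases hu with rfl | hu
      · exact Ideal.mem_sup_right (Ideal.mem_span_singleton_self _)
      · exact Ideal.mem_sup_left (Ideal.subset_span ⟨u, hu, hu1, rfl⟩)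
    refine (Ideal.pow_right_mono hsplit _).trans (Ideal.sup_pow_add_le_pow_sup_pow.trans
      (sup_le ?_ ?_))
    · rw [pow_mul]
      refine (Ideal.pow_right_mono hfN _).trans ?_
      rw [Ideal.span_singleton_pow, Ideal.span_singleton_le_span_singleton]
      exact hpx
    · rw [Ideal.span_singleton_pow, Ideal.span_singleton_le_span_singleton]
      rw [pow_mul]
      convert hpy using 2
      rw [← fiberMonomial_pow]
      exact fiberMonomial_congr (one_mul _) rfl _ _

theorem fiberMonomial_mem_fiberSpan_pow {T : Set A} (hT : Ideal.span T = I) (n : ℕ) {u : A}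
    (hu : u ∈ I ^ n) : fiberMonomial I m n u hu ∈ fiberSpan I m T ^ n := by
  have hone : ∀ w, ∀ hw : w ∈ I ^ 1, fiberMonomial I m 1 w hw ∈ fiberSpan I m T := by
    intro w hw
    have hw' : w ∈ Ideal.span T := by rwa [hT, ← pow_one I]
    have hsub : ∀ x ∈ Ideal.span T, x ∈ I ^ 1 := fun x hx => by rwa [pow_one, ← hT]
    suffices ∀ x, ∀ hx : x ∈ Ideal.span T, fiberMonomial I m 1 x (hsub x hx) ∈ fiberSpan I m T from
      this w hw'
    intro x hx
    induction hx using Submodule.span_induction with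
    | mem x h => exact Ideal.subset_span ⟨x, h, _, rfl⟩
    | zero => rw [fiberMonomial_eq_zero _ (zero_mem _)]; exact zero_mem _
    | add x y hx hy h1 h2 => rw [fiberMonomial_add (hsub x hx) (hsub y hy)]; exact add_mem h1 h2
    | smul c x hx h1 =>
      have := Submodule.smul_of_tower_mem (fiberSpan I m T) c h1
      rwa [← fiberMonomial_smul] at this
  induction n generalizing u with
  | zero => rw [pow_zero, Ideal.one_eq_top]; exact Submodule.mem_top
  | succ n ih =>
    have key : ∀ x, ∀ hx : x ∈ I ^ n * I ^ 1,
        fiberMonomial I m (n + 1) x (by rwa [pow_add]) ∈ fiberSpan I m T ^ (n + 1) := by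
      intro x hx
      induction hx using Submodule.mul_induction_on' with
      | mem_mul_mem v hv w hw =>
        rw [fiberMonomial_mul hv hw, pow_succ]
        exact Ideal.mul_mem_mul (ih hv) (hone w hw)
      | add x hx y hy h1 h2 =>
        rw [fiberMonomial_add (by rwa [pow_add]) (by rwa [pow_add])]
        exact add_mem h1 h2
    exact key u (by rwa [← pow_add])

/-- If an ideal is generated by `j` elements, a power of it is, modulo `m`, a multiple of a
lower power by one element. -/
theorem exists_pow_le_span_mul_pow_sup (m : Ideal A) (e j : ℕ) :
    ∃ D ≥ 1, ∃ N ≥ D, ∀ I : Ideal A, FiberDimLE I m e → ∀ T : Finset A, T.card ≤ j →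
      Ideal.span (T : Set A) = I →
      ∃ f ∈ I ^ D, I ^ N ≤ Ideal.span {f} * I ^ (N - D) ⊔ m * I ^ N := by
  obtain ⟨D, hD, N, h⟩ := exists_fiberSpan_pow_le m e j
  -- The maximum ensures that the subtraction N - D is not truncated.
  refine ⟨D, hD, max N D, le_max_right _ _, fun I he T hT hTI => ?_⟩
  obtain ⟨f, hf, hfN⟩ := h I he T hT (hTI ▸ Ideal.subset_span)
  refine ⟨f, hf, fun u hu => ?_⟩
  have h1 := hfN (Ideal.pow_le_pow_right (le_max_left N D)
    (fiberMonomial_mem_fiberSpan_pow (m := m) hTI _ hu))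
  obtain ⟨b, hb⟩ := Ideal.mem_span_singleton.1 h1
  obtain ⟨z, rfl⟩ := FiberRing.mk_surjective I m b
  rw [fiberMonomial, fiberMonomial, ← map_mul] at hb
  have h2 := FiberRing.mk_eq_mk_iff.1 hb (max N D)
  have h3 : ((reesMonomial I (max N D) u hu - reesMonomial I D f hf * z : reesAlgebra I) :
      A[X]).coeff (max N D) = u - f * (z : A[X]).coeff (max N D - D) := by
    simp only [reesMonomial, AddSubgroupClass.coe_sub, MulMemClass.coe_mul, Polynomial.coeff_sub,
      Polynomial.coeff_monomial, if_true]
    congr 1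
    conv_lhs => rw [← Nat.sub_add_cancel (le_max_right N D)]
    rw [← Polynomial.C_mul_X_pow_eq_monomial, mul_assoc, Polynomial.coeff_C_mul, mul_comm (_ ^ _),
      Polynomial.coeff_mul_X_pow]
  rw [h3] at h2
  rw [← add_sub_cancel (f * (z : A[X]).coeff (max N D - D)) u]
  exact Submodule.add_mem_sup (Ideal.mul_mem_mul (Ideal.mem_span_singleton_self f)
    ((mem_reesAlgebra_iff I z).1 z.2 _)) h2

end

/-! ### Uniform reductions in dimension one -/

/-- By Nakayama's lemma, `I` has at most `e` generators if `I / mI` has length at most `e`. -/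
theorem FiberDimLE.exists_finset_span_eq {A : Type*} [CommRing A] {I m : Ideal A} {e : ℕ}
    (he : FiberDimLE I m e) (hm : m ≤ (⊥ : Ideal A).jacobson) (hI : I.FG) :
    ∃ T : Finset A, T.card ≤ e ∧ Ideal.span (T : Set A) = I := by
  classical
  have hex : ∃ n, ∃ T : Finset A, T.card = n ∧ Ideal.span (T : Set A) = I :=
    let ⟨T, hT⟩ := hI
    ⟨_, T, rfl, hT⟩
  -- In a generating set of minimal size above e, the degree-one relation would make some generator
  -- redundant.
  obtain ⟨T, hcard, hT⟩ := Nat.find_spec hex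
  refine ⟨T, ?_, hT⟩
  by_contra! hlt
  let u : ℕ → A := fun i => if hi : i < T.card then T.equivFin.symm ⟨i, hi⟩ else 0
  have huT : ∀ i ≤ e, u i ∈ T := fun i hi => by simp [u, hi.trans_lt hlt]
  have hinj : ∀ i ≤ e, ∀ j ≤ e, u i = u j → i = j := fun i hi j hj h => by
    simpa [u, hi.trans_lt hlt, hj.trans_lt hlt] using h
  obtain ⟨s, hs, c, hc⟩ := he 1 u fun i hi => by
    rw [pow_one, ← hT]
    exact Ideal.subset_span (huT i hi)
  rw [pow_one] at hc
  have hle : I ≤ Ideal.span (T.erase (u s) : Set A) ⊔ m • I := by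
    conv_lhs => rw [← hT]
    refine Ideal.span_le.2 fun x hx => ?_
    by_cases hxs : x = u s
    · have hsum : ∑ i ∈ Finset.Ioc s e, c i * u i ∈ Ideal.span (T.erase (u s) : Set A) := by
        refine Ideal.sum_mem _ fun i hi => Ideal.mul_mem_left _ _ (Ideal.subset_span ?_)
        rw [Finset.mem_Ioc] at hi
        refine Finset.mem_coe.2 (Finset.mem_erase.2 ⟨fun h => ?_, huT i hi.2⟩)
        exact hi.1.ne' (hinj i hi.2 s hs h)
      have := sub_mem (Ideal.mem_sup_right (S := Ideal.span (T.erase (u s) : Set A)) hc)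
        (Ideal.mem_sup_left hsum)
      rw [add_sub_cancel_right] at this
      rw [hxs]
      exact this
    · exact Ideal.mem_sup_left (Ideal.subset_span (Finset.mem_coe.2 (Finset.mem_erase.2 ⟨hxs, hx⟩)))
  have hle' : I ≤ Ideal.span (T.erase (u s) : Set A) :=
    Submodule.le_of_le_smul_of_le_jacobson_bot hI hm hle
  refine Nat.find_min hex ?_ ⟨T.erase (u s), rfl, le_antisymm ?_ hle'⟩
  · rw [← hcard]
    exact Finset.card_erase_lt_of_mem (huT s hs)
  · rw [← hT]
    exact Ideal.span_mono (Finset.coe_subset.2 (Finset.erase_subset _ _))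

/-- In a Noetherian ring of dimension at most one, an ideal containing a nonzerodivisor has
finite colength. -/
theorem length_quotient_ne_top_of_mem_nonZeroDivisors {A : Type*} [CommRing A]
    [IsNoetherianRing A] (hdim : ringKrullDim A ≤ 1) {a : A} (ha : a ∈ nonZeroDivisors A)
    {Q : Submodule A A} (haQ : a ∈ Q) : Module.length A (A ⧸ Q) ≠ ⊤ := by
  have h1 := (ringKrullDim_quotient_succ_le_of_nonZeroDivisor ha).trans hdim
  have h0 : ringKrullDim (A ⧸ Ideal.span {a}) ≤ 0 :=
    ENat.WithBot.add_le_add_natCast_right_iff.mp h1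
  have : Ring.KrullDimLE 0 (A ⧸ Ideal.span {a}) := Ring.krullDimLE_iff.2 h0
  have : IsArtinianRing (A ⧸ Ideal.span {a}) :=
    isArtinianRing_iff_isNoetherianRing_krullDimLE_zero.2 ⟨inferInstance, this⟩
  have : IsArtinian A (A ⧸ Ideal.span {a}) :=
    isArtinian_of_surjective_algebraMap (Ideal.Quotient.mk_surjective (I := Ideal.span {a}))
  have hle : (Ideal.span {a} : Submodule A A) ≤ Q := (Ideal.span_singleton_le_iff_mem Q).2 haQ
  have : IsArtinian A (A ⧸ Q) :=
    isArtinian_of_surjective _ (Submodule.factor hle) (Submodule.factor_surjective hle)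
  exact Module.length_ne_top

/-- In a one-dimensional Noetherian local ring, all ideals containing a nonzerodivisor have a
power that is a multiple of a lower power by a single element, with uniform exponents. -/
theorem exists_pow_le_span_mul_pow {A : Type*} [CommRing A] [IsLocalRing A] [IsNoetherianRing A]
    (hdim : ringKrullDim A ≤ 1) :
    ∃ D ≥ 1, ∃ N ≥ D, ∀ I : Ideal A, ∀ a ∈ I, a ∈ nonZeroDivisors A →
      ∃ f ∈ I ^ D, I ^ N ≤ Ideal.span {f} * I ^ (N - D) := by
  set m := IsLocalRing.maximalIdeal A with hmdef
  have hm : m ≤ (⊥ : Ideal A).jacobson := IsLocalRing.maximalIdeal_le_jacobson _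
  by_cases hy : ∃ y ∈ m, y ∈ nonZeroDivisors A
  · obtain ⟨y, hy, hreg⟩ := hy
    obtain ⟨e, he⟩ := ENat.ne_top_iff_exists.1 (length_quotient_ne_top_of_mem_nonZeroDivisors hdim
      hreg (Submodule.mem_span_singleton_self y))
    obtain ⟨D, hD, N, hN, h⟩ := exists_pow_le_span_mul_pow_sup m e e
    refine ⟨D, hD, N, hN, fun I a haI ha => ?_⟩
    have hfib : FiberDimLE I m e := fun n u hu => by
      refine exists_linear_relation_of_length_le m (I ^ n) e ?_ u hu
      rw [he]
      exact length_quotient_smul_le m y hy hreg _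
        (length_quotient_ne_top_of_mem_nonZeroDivisors hdim (pow_mem ha n)
          (Ideal.pow_mem_pow haI n))
    obtain ⟨T, hT, hTI⟩ := hfib.exists_finset_span_eq hm (IsNoetherian.noetherian I)
    obtain ⟨f, hf, hle⟩ := h I hfib T hT hTI
    exact ⟨f, hf, Submodule.le_of_le_smul_of_le_jacobson_bot (IsNoetherian.noetherian _) hm hle⟩
  -- Without a nonzerodivisor in 𝔪, only the unit ideal qualifies.
  · refine ⟨1, le_rfl, 1, le_rfl, fun I a haI ha => ?_⟩
    have hI : I = ⊤ := by
      by_contra hI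
      exact hy ⟨a, IsLocalRing.le_maximalIdeal hI haI, ha⟩
    exact ⟨1, by simp [hI], by simp [hI]⟩

/-! ### From reductions to strong Artin–Rees -/

/-- The step form of the strong Artin-Rees property, for ideals containing an element that is
regular modulo `J`. -/
theorem exists_forall_pow_succ_inf_le_of_regular {R : Type*} [CommRing R] [IsLocalRing R]
    [IsNoetherianRing R] (J : Ideal R) (hJ : ringKrullDim (R ⧸ J) ≤ 1) :
    ∃ h : ℕ, ∀ I : Ideal R, ∀ a ∈ I, (∀ v, a * v ∈ J → v ∈ J) →
      ∀ n ≥ h, I ^ (n + 1) ⊓ J ≤ I * (I ^ n ⊓ J) := by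
  rcases eq_or_ne J ⊤ with rfl | hJtop
  · exact ⟨0, fun I _ _ _ n _ => by simp [pow_succ']⟩
  have : Nontrivial (R ⧸ J) := Ideal.Quotient.nontrivial_iff.2 hJtop
  have : IsLocalRing (R ⧸ J) :=
    IsLocalRing.of_surjective' (Ideal.Quotient.mk J) Ideal.Quotient.mk_surjective
  obtain ⟨D, hD, N, hN, hred⟩ := exists_pow_le_span_mul_pow hJ
  refine ⟨N, fun I a haI ha n hn => ?_⟩
  have hreg : Ideal.Quotient.mk J a ∈ nonZeroDivisors (R ⧸ J) := by
    refine mem_nonZeroDivisors_iff_right.2 fun x hx => ?_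
    obtain ⟨v, rfl⟩ := Ideal.Quotient.mk_surjective x
    rw [← map_mul, Ideal.Quotient.eq_zero_iff_mem, mul_comm] at hx
    exact Ideal.Quotient.eq_zero_iff_mem.2 (ha v hx)
  obtain ⟨f', hf', hle'⟩ := hred (I.map (Ideal.Quotient.mk J)) _ (Ideal.mem_map_of_mem _ haI) hreg
  obtain ⟨f, hf, rfl⟩ : ∃ f ∈ I ^ D, Ideal.Quotient.mk J f = f' := by
    rw [← Ideal.map_pow] at hf'
    exact (Ideal.mem_map_iff_of_surjective _ Ideal.Quotient.mk_surjective).1 hf'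
  have hle : I ^ N ≤ Ideal.span {f} * I ^ (N - D) ⊔ J := by
    rw [← Ideal.map_pow, ← Ideal.map_pow, ← Set.image_singleton, ← Ideal.map_span,
      ← Ideal.map_mul, Ideal.map_le_iff_le_comap,
      Ideal.comap_map_of_surjective' _ Ideal.Quotient.mk_surjective, Ideal.mk_ker] at hle'
    exact hle'
  have hfI : Ideal.span {f} ≤ I ^ D := (Ideal.span_singleton_le_iff_mem _).2 hf
  -- f inherits regularity from a, because a^N ∈ fR + J.
  have hfreg : ∀ v, f * v ∈ J → v ∈ J := by
    intro v hv
    have hpow : ∀ k, ∀ v, a ^ k * v ∈ J → v ∈ J := by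
      intro k
      induction k with
      | zero => simp
      | succ k ih => exact fun v hv => ih v (ha _ (by rwa [← mul_assoc, ← pow_succ']))
    refine hpow N v ?_
    obtain ⟨p, hp, q, hq, hpq⟩ := Submodule.mem_sup.1 (hle (Ideal.pow_mem_pow haI N))
    obtain ⟨r, -, rfl⟩ := Ideal.mem_span_singleton_mul.1 hp
    rw [← hpq, show (f * r + q) * v = r * (f * v) + q * v by ring]
    exact add_mem (Ideal.mul_mem_left _ _ hv) (Ideal.mul_mem_right _ _ hq)
  -- Modular law: f I^(N-D) already lies in I^N.
  have hle2 : I ^ N ≤ Ideal.span {f} * I ^ (N - D) ⊔ (I ^ N ⊓ J) := by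
    intro x hx
    obtain ⟨p, hp, q, hq, rfl⟩ := Submodule.mem_sup.1 (hle hx)
    have hpN : p ∈ I ^ N := by
      have := Ideal.mul_mono_left hfI hp
      rwa [← pow_add, Nat.add_sub_cancel' hN] at this
    exact Submodule.add_mem_sup hp ⟨by simpa using sub_mem hx hpN, hq⟩
  rintro u ⟨hu, huJ⟩
  have hu' : u ∈ I ^ (n + 1 - N) * (Ideal.span {f} * I ^ (N - D) ⊔ (I ^ N ⊓ J)) := by
    refine Ideal.mul_mono_right hle2 ?_
    rwa [← pow_add, Nat.sub_add_cancel (by omega)]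
  rw [Ideal.mul_sup, mul_left_comm, ← pow_add] at hu'
  obtain ⟨p, hp, w, hw, rfl⟩ := Submodule.mem_sup.1 hu'
  obtain ⟨v, hv, rfl⟩ := Ideal.mem_span_singleton_mul.1 hp
  have hwI : w ∈ I * (I ^ n ⊓ J) := by
    have h1 : I ^ (n + 1 - N) * (I ^ N ⊓ J) ≤ I * (I ^ n ⊓ J) := by
      rw [show n + 1 - N = (n - N) + 1 by omega, pow_succ', mul_assoc]
      refine Ideal.mul_mono_right (le_inf ?_ (Ideal.mul_le_right.trans inf_le_right))
      refine (Ideal.mul_mono_right inf_le_left).trans ?_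
      rw [← pow_add, Nat.sub_add_cancel hn]
    exact h1 hw
  have hwJ : w ∈ J := (Ideal.mul_le_right.trans inf_le_right) hwI
  have hvJ : v ∈ J := hfreg v (by simpa using sub_mem huJ hwJ)
  refine add_mem ?_ hwI
  have h2 : f * v ∈ I ^ D * (I ^ (n + 1 - D) ⊓ J) := by
    refine Ideal.mul_mem_mul hf ⟨?_, hvJ⟩
    rwa [show n + 1 - D = n + 1 - N + (N - D) by omega]
  have h3 : I ^ D * (I ^ (n + 1 - D) ⊓ J) ≤ I * (I ^ n ⊓ J) := by
    obtain ⟨d, rfl⟩ : ∃ d, D = d + 1 := ⟨D - 1, by omega⟩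
    rw [pow_succ', mul_assoc]
    refine Ideal.mul_mono_right (le_inf ?_ (Ideal.mul_le_right.trans inf_le_right))
    refine (Ideal.mul_mono_right inf_le_left).trans ?_
    rw [← pow_add]
    exact Ideal.pow_le_pow_right (by omega)
  exact h3 h2

/-- The step form of the strong Artin-Rees property. -/
theorem exists_forall_pow_succ_inf_le {R : Type*} [CommRing R] [IsLocalRing R]
    [IsNoetherianRing R] (J : Ideal R) (hJ : ringKrullDim (R ⧸ J) ≤ 1) :
    ∃ h : ℕ, ∀ I : Ideal R, ∀ n ≥ h, I ^ (n + 1) ⊓ J ≤ I * (I ^ n ⊓ J) := by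
  classical
  obtain ⟨s, hs, hprim⟩ : ∃ s : Finset (Ideal R), s.inf id = J ∧ ∀ q ∈ s, q.IsPrimary :=
    Submodule.isLasker R R J
  have hdim : ∀ t ∈ s.powerset, ringKrullDim (R ⧸ (t.inf id : Ideal R)) ≤ 1 := fun t ht =>
    (ringKrullDim_le_of_surjective (Ideal.Quotient.factor
      (hs ▸ Finset.inf_mono (Finset.mem_powerset.1 ht) : J ≤ t.inf id))
      (Ideal.Quotient.factor_surjective _)).trans hJ
  -- The surviving set t depends on I, so a bound is fixed for each subset of s and their supremum
  -- taken.
  have hex : ∀ t : Finset (Ideal R), ∃ h : ℕ, t ∈ s.powerset → ∀ I : Ideal R, ∀ a ∈ I,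
      (∀ v, a * v ∈ t.inf id → v ∈ t.inf id) →
      ∀ n ≥ h, I ^ (n + 1) ⊓ t.inf id ≤ I * (I ^ n ⊓ t.inf id) := by
    intro t
    by_cases ht : t ∈ s.powerset
    · exact (exists_forall_pow_succ_inf_le_of_regular (t.inf id) (hdim t ht)).imp fun _ h _ => h
    · exact ⟨0, fun h => absurd h ht⟩
  choose h hh using hex
  have hex' : ∀ q : Ideal R, ∃ k : ℕ, q.radical ^ k ≤ q :=
    fun q => q.exists_radical_pow_le_of_fg q.radical.fg_of_isNoetherianRing
  choose k hk using hex'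
  refine ⟨max (s.powerset.sup h) (s.sup k), fun I n hn => ?_⟩
  set t := s.filter fun q => ¬ I ≤ q.radical with ht
  have hts : t ∈ s.powerset := Finset.mem_powerset.2 (Finset.filter_subset _ _)
  have hinf : ∀ l ≥ s.sup k, I ^ l ⊓ J = I ^ l ⊓ t.inf id := by
    intro l hl
    refine le_antisymm (inf_le_inf_left _ (hs ▸ Finset.inf_mono (Finset.filter_subset _ _))) ?_
    refine le_inf inf_le_left (hs ▸ Finset.le_inf fun q hq => ?_)
    by_cases hIq : I ≤ q.radical
    · exact inf_le_left.trans ((Ideal.pow_right_mono hIq l).trans ((Ideal.pow_le_pow_right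
        ((Finset.le_sup (f := k) hq).trans hl)).trans (hk q)))
    · exact inf_le_right.trans (Finset.inf_le (Finset.mem_filter.2 ⟨hq, hIq⟩))
  obtain ⟨a, haI, hat⟩ : ∃ a ∈ I, ∀ q ∈ t, a ∉ q.radical := by
    by_contra! hcon
    have hsub : (I : Set R) ⊆ ⋃ q ∈ (t : Set (Ideal R)), (q.radical : Set R) := fun a ha => by
      obtain ⟨q, hq, haq⟩ := hcon a ha
      exact Set.mem_biUnion hq haq
    -- The two `⊥` are dummy exceptional indices: all the radicals are prime.
    obtain ⟨q, hq, hIq⟩ := (Ideal.subset_union_prime (f := Ideal.radical) ⊥ ⊥ fun q hq _ _ =>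
      Ideal.isPrime_radical (hprim q (Finset.mem_filter.1 hq).1)).1 hsub
    exact (Finset.mem_filter.1 hq).2 hIq
  rw [hinf n ((le_max_right _ _).trans hn), hinf (n + 1) (((le_max_right _ _).trans hn).trans
    n.le_succ)]
  refine hh t hts I a haI (fun v hv => ?_) n
    ((Finset.le_sup (f := h) hts).trans ((le_max_left _ _).trans hn))
  rw [Submodule.mem_finsetInf] at hv ⊢
  intro q hq
  have hav : v * a ∈ q := by rw [mul_comm]; exact hv q hq
  exact ((Ideal.isPrimary_iff.1 (hprim q (Finset.mem_filter.1 hq).1)).2 hav).resolve_right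
    (hat q hq)

theorem mainTheorem3 {R : Type*} [CommRing R] [IsLocalRing R] [IsNoetherianRing R] (J : Ideal R)
    (hJ : ringKrullDim (R ⧸ J) ≤ 1) :
    HasStrongArtinReesProperty (M := R) J := by
  obtain ⟨h, hh⟩ := exists_forall_pow_succ_inf_le J hJ
  refine ⟨h, fun I _ n hn => ?_⟩
  have key : ∀ k, I ^ (h + k) ⊓ J = I ^ k * (I ^ h ⊓ J) := by
    intro k
    refine le_antisymm ?_ (le_inf ?_ (Ideal.mul_le_right.trans inf_le_right))
    · induction k with
      | zero => simp
      | succ k ih =>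
        rw [← add_assoc, pow_succ' I k, mul_assoc]
        exact (hh I (h + k) (h.le_add_right k)).trans (Ideal.mul_mono_right ih)
    · rw [add_comm, pow_add]
      exact Ideal.mul_mono_right inf_le_left
  obtain ⟨k, rfl⟩ := Nat.exists_eq_add_of_le hn
  simpa using key k
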